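/- Let $\left(\frac{n}{5}\right)$ denote the Legendre symbol modulo $5$, and for complex $a,q$ with $|q|<1$ let $$(a;q)_\infty=\prod_{n\ge 0}(1-aq^n)=(1-a)(1-aq)(1-aq^2)\cdots .$$ Then for every complex number $q$ with $|q|<1$ the series and the infinite products below converge, $(q^5;q^5)_\infty\neq 0$, and $$1-5\sum_{n\ge 1}\left(\frac{n}{5}\right)\frac{n\,q^n}{1-q^n}=\frac{(q;q)_\infty^5}{(q^5;q^5)_\infty}.$$ -/

import Mathlib

/-- The infinite q-Pochhammer symbol `(a;q)_∞ = (1-a)(1-aq)(1-aq²)⋯`. -/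
noncomputable def qPochInf (a q : ℂ) : ℂ := ∏' n : ℕ, (1 - a * q ^ n)

/-- Primality of 5, needed for the Legendre symbol `legendreSym 5`. -/
instance fact_prime_five_inst : Fact (Nat.Prime 5) := ⟨Nat.prime_five⟩

/-! Write `E = (q;q)_∞` and `θ_a = ∑ (-1)^n q^(an + 5n(n-1)/2)` for `a = 1, 2`. By the triple
product, `θ_a` is a product over the exponents congruent to `0, a, -a` mod 5. Hence `θ_1 θ_2 = E ·
(q⁵;q⁵)_∞`, and the logarithmic derivative `q θ_a'/θ_a` is minus a sum of Lambert series over those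
classes. In the difference for `a = 1` and `a = 2` the class `0` cancels and the other classes carry
the signs of the Legendre symbol. So the left side of the theorem times `θ_1 θ_2` is `W = θ_1 θ_2 +
5 (qθ_1' θ_2 - θ_1 qθ_2')`, and all rests on `W = E⁶` (`theta_wronskian`).

For that, square Jacobi's series for `E³`. With `x = 2i-1`, `y = 2j-1`, the weight `3(x²-y²) - 8xy =
Re ((2+i)²(x+iy)²)` (here `i` beside `2` and `y` is the imaginary unit) gives a double series of
value `-32 E⁶`. Split the lattice into five classes modulo a Gaussian prime of norm 5. A quarter
turn permutes four of them cyclically, each contributing `-8 W`; the fifth contributes 0 by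
antisymmetry. -/

open Filter Topology

/-! ### Triangular numbers and q-factorials -/

/-- The triangular number `n(n-1)/2` for an integer `n`. -/
def tri (n : ℤ) : ℤ := n * (n - 1) / 2

lemma two_mul_tri (n : ℤ) : 2 * tri n = n * (n - 1) := by
  unfold tri
  exact Int.mul_ediv_cancel' (by
    have := (Int.even_mul_pred_self n).two_dvd
    simpa using this)

lemma tri_sub_one (n : ℤ) : tri (n - 1) = tri n - n + 1 := by
  have h1 := two_mul_tri n
  have h2 := two_mul_tri (n - 1)
  linarith

lemma tri_add_one (n : ℤ) : tri (n + 1) = tri n + n := by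
  have h1 := two_mul_tri n
  have h2 := two_mul_tri (n + 1)
  linarith

lemma tri_one_sub (n : ℤ) : tri (1 - n) = tri n := by
  have h1 := two_mul_tri n
  have h2 := two_mul_tri (1 - n)
  linarith

/-- The finite product `(q;q)_k = (1-q)⋯(1-q^k)`. -/
noncomputable def qFac (q : ℂ) (k : ℕ) : ℂ := ∏ i ∈ Finset.range k, (1 - q ^ (i + 1))

/-- The reciprocal of `(q;q)_k`, extended by zero to negative `k`. -/
noncomputable def qFacInv (q : ℂ) (k : ℤ) : ℂ := if 0 ≤ k then (qFac q k.toNat)⁻¹ else 0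

lemma one_sub_mul_pow_ne_zero {q x : ℂ} (hq : ‖q‖ < 1) (hx : ‖x‖ < 1) (n : ℕ) :
    1 - x * q ^ n ≠ 0 := by
  rw [sub_ne_zero]
  intro h
  have h1 : ‖x * q ^ n‖ < 1 := by
    rw [norm_mul, norm_pow]
    exact mul_lt_one_of_nonneg_of_lt_one_left (norm_nonneg _) hx
      (pow_le_one₀ (norm_nonneg _) hq.le)
  rw [← h] at h1
  simp at h1

lemma summable_norm_mul_pow {q : ℂ} (hq : ‖q‖ < 1) (x : ℂ) :
    Summable fun n : ℕ => ‖-(x * q ^ n)‖ := by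
  simpa using (summable_geometric_of_lt_one (norm_nonneg _) hq).mul_left ‖x‖

lemma multipliable_one_sub_mul_pow {q : ℂ} (hq : ‖q‖ < 1) (x : ℂ) :
    Multipliable fun n : ℕ => 1 - x * q ^ n := by
  simpa [sub_eq_add_neg] using multipliable_one_add_of_summable (summable_norm_mul_pow hq x)

lemma qPochInf_ne_zero {q x : ℂ} (hq : ‖q‖ < 1) (hx : ‖x‖ < 1) : qPochInf x q ≠ 0 := by
  have := tprod_one_add_ne_zero_of_summable (f := fun n : ℕ => -(x * q ^ n))
    (fun n => by simpa [sub_eq_add_neg] using one_sub_mul_pow_ne_zero hq hx n)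
    (summable_norm_mul_pow hq x)
  simpa [qPochInf, sub_eq_add_neg] using this

lemma tendsto_prod_qPochInf {q : ℂ} (hq : ‖q‖ < 1) (x : ℂ) :
    Tendsto (fun N => ∏ i ∈ Finset.range N, (1 - x * q ^ i)) atTop (𝓝 (qPochInf x q)) :=
  (multipliable_one_sub_mul_pow hq x).hasProd.tendsto_prod_nat

lemma qFac_eq (q : ℂ) (k : ℕ) : qFac q k = ∏ i ∈ Finset.range k, (1 - q * q ^ i) := by
  simp [qFac, pow_succ']

lemma tendsto_qFac {q : ℂ} (hq : ‖q‖ < 1) : Tendsto (qFac q) atTop (𝓝 (qPochInf q q)) := by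
  simpa only [← qFac_eq] using tendsto_prod_qPochInf hq q

lemma qFac_ne_zero {q : ℂ} (hq : ‖q‖ < 1) (k : ℕ) : qFac q k ≠ 0 := by
  rw [qFac_eq]
  exact Finset.prod_ne_zero_iff.2 fun i _ => one_sub_mul_pow_ne_zero hq hq i

/-- The extension by zero makes this hold for every integer: at `k = 0` the factor `1 - q^0`
vanishes. No boundary cases then arise in the recurrences below. -/
lemma qFacInv_sub_one {q : ℂ} (hq : ‖q‖ < 1) (k : ℤ) :
    qFacInv q (k - 1) = (1 - q ^ k) * qFacInv q k := by
  rcases lt_trichotomy k 0 with h | rfl | h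
  · rw [qFacInv, qFacInv, if_neg (by omega), if_neg (by omega), mul_zero]
  · simp [qFacInv]
  · obtain ⟨m, rfl⟩ : ∃ m : ℕ, k = m + 1 := ⟨(k - 1).toNat, by omega⟩
    rw [qFacInv, qFacInv, if_pos (by omega), if_pos (by omega)]
    have e1 : ((m : ℤ) + 1 - 1).toNat = m := by omega
    have e2 : ((m : ℤ) + 1).toNat = m + 1 := by omega
    have e3 : q ^ ((m : ℤ) + 1) = q ^ (m + 1) := by exact_mod_cast zpow_natCast q (m + 1)
    have h0 := qFac_ne_zero hq (m + 1)
    rw [e1, e2, e3]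
    have : qFac q (m + 1) = qFac q m * (1 - q ^ (m + 1)) := by
      simp [qFac, Finset.prod_range_succ]
    rw [this] at h0 ⊢
    have := left_ne_zero_of_mul h0
    have := right_ne_zero_of_mul h0
    field_simp

/-! ### Jacobi's triple product and cube identities -/

/-- The coefficients of the finite Jacobi triple product. -/
noncomputable def tripleCoeff (q : ℂ) (N : ℕ) (n : ℤ) : ℂ :=
  qFac q (2 * N) * qFacInv q (N + n) * qFacInv q (N - n)

/-- Coefficient form of multiplying by `(1 + z q^N)(1 + z⁻¹ q^(N+1)) = 1 + q^(2N+1) + z q^N + z⁻¹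
q^(N+1)`: the last two terms shift the index by one. -/
lemma tripleCoeff_succ {q z : ℂ} (hq : ‖q‖ < 1) (hq0 : q ≠ 0) (hz : z ≠ 0) (N : ℕ) (n : ℤ) :
    tripleCoeff q (N + 1) n * (z ^ n * q ^ tri n) =
      (1 + q ^ (2 * N + 1)) * (tripleCoeff q N n * (z ^ n * q ^ tri n)) +
      z * q ^ N * (tripleCoeff q N (n - 1) * (z ^ (n - 1) * q ^ tri (n - 1))) +
      z⁻¹ * q ^ (N + 1) * (tripleCoeff q N (n + 1) * (z ^ (n + 1) * q ^ tri (n + 1))) := by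
  have hA : qFacInv q (N + n) = (1 - q ^ ((N : ℤ) + n + 1)) * qFacInv q (N + n + 1) := by
    rw [← qFacInv_sub_one hq]; congr 1; ring
  have hB : qFacInv q (N - n) = (1 - q ^ ((N : ℤ) - n + 1)) * qFacInv q (N - n + 1) := by
    rw [← qFacInv_sub_one hq]; congr 1; ring
  have hA' : qFacInv q (N + (n - 1)) = (1 - q ^ ((N : ℤ) + n)) * qFacInv q (N + n) := by
    rw [← qFacInv_sub_one hq]; congr 1; ring
  have hB' : qFacInv q (N - (n + 1)) = (1 - q ^ ((N : ℤ) - n)) * qFacInv q (N - n) := by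
    rw [← qFacInv_sub_one hq]; congr 1; ring
  have hF : qFac q (2 * (N + 1)) = qFac q (2 * N) * (1 - q ^ (2 * N + 1)) * (1 - q ^ (2 * N + 2)) := by
    simp [qFac, mul_add, Finset.prod_range_succ]
  have e1 : (N : ℤ) - (n - 1) = N - n + 1 := by ring
  have e2 : (N : ℤ) + (n + 1) = N + n + 1 := by ring
  have e3 : ((N + 1 : ℕ) : ℤ) + n = N + n + 1 := by push_cast; ring
  have e4 : ((N + 1 : ℕ) : ℤ) - n = N - n + 1 := by push_cast; ring
  simp only [tripleCoeff, e1, e2, e3, e4, hF, hA', hB', hA, hB, tri_sub_one, tri_add_one]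
  generalize qFacInv q (N + n + 1) = A
  generalize qFacInv q (N - n + 1) = B
  simp only [zpow_add₀ hq0, zpow_sub₀ hq0, zpow_add₀ hz, zpow_sub₀ hz, zpow_one, zpow_natCast,
    pow_add, pow_mul, pow_one]
  have : q ^ n ≠ 0 := zpow_ne_zero _ hq0
  field_simp
  ring

lemma hasSum_tripleCoeff {q z : ℂ} (hq : ‖q‖ < 1) (hq0 : q ≠ 0) (hz : z ≠ 0) (N : ℕ) :
    HasSum (fun n : ℤ => tripleCoeff q N n * (z ^ n * q ^ tri n))
      (∏ i ∈ Finset.range N, (1 + z * q ^ i) * (1 + z⁻¹ * q ^ (i + 1))) := by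
  induction N with
  | zero =>
    have h0 : ∀ n : ℤ, n ≠ 0 → tripleCoeff q 0 n * (z ^ n * q ^ tri n) = 0 := fun n hn => by
      rcases lt_or_gt_of_ne hn with h | h <;> simp [tripleCoeff, qFacInv, h]
    simpa [tripleCoeff, qFac, qFacInv, tri] using hasSum_single (0 : ℤ) h0
  | succ N ih =>
    have h1 := (Equiv.subRight (1 : ℤ)).hasSum_iff.2 ih
    have h2 := (Equiv.addRight (1 : ℤ)).hasSum_iff.2 ih
    convert! ((ih.mul_left (1 + q ^ (2 * N + 1))).add (h1.mul_left (z * q ^ N))).add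
      (h2.mul_left (z⁻¹ * q ^ (N + 1))) using 1
    · ext n
      exact tripleCoeff_succ hq hq0 hz N n
    · rw [Finset.prod_range_succ]
      generalize ∏ i ∈ Finset.range N, (1 + z * q ^ i) * (1 + z⁻¹ * q ^ (i + 1)) = P
      field_simp
      ring

/-- An algebraic substitute for applying `z d/dz` to the finite triple product at `z = -1`: the
weight `n` turns the recurrence in `N` into one for the pair (weighted sum, plain sum). -/
lemma hasSum_mul_tripleCoeff {q : ℂ} (hq : ‖q‖ < 1) (hq0 : q ≠ 0) (N : ℕ) :
    HasSum (fun n : ℤ => (n : ℂ) * (tripleCoeff q (N + 1) n * ((-1) ^ n * q ^ tri n)))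
      (-(qFac q N * qFac q (N + 1))) := by
  have hm : (-1 : ℂ) ≠ 0 := by norm_num
  have key : ∀ (N : ℕ) (D S : ℂ),
      HasSum (fun n : ℤ => (n : ℂ) * (tripleCoeff q N n * ((-1) ^ n * q ^ tri n))) D →
      HasSum (fun n : ℤ => tripleCoeff q N n * ((-1) ^ n * q ^ tri n)) S →
      HasSum (fun n : ℤ => (n : ℂ) * (tripleCoeff q (N + 1) n * ((-1) ^ n * q ^ tri n)))
        ((1 - q ^ N) * (1 - q ^ (N + 1)) * D + (q ^ (N + 1) - q ^ N) * S) := by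
    intro N D S hD hS
    have h1 := (Equiv.subRight (1 : ℤ)).hasSum_iff.2 (hD.add hS)
    have h2 := (Equiv.addRight (1 : ℤ)).hasSum_iff.2 (hD.sub hS)
    convert! ((hD.mul_left (1 + q ^ (2 * N + 1))).add (h1.mul_left (-1 * q ^ N))).add
      (h2.mul_left ((-1)⁻¹ * q ^ (N + 1))) using 1
    · ext n
      rw [tripleCoeff_succ hq hq0 hm N n]
      simp only [Function.comp_apply, Equiv.subRight_apply, Equiv.coe_addRight]
      push_cast
      ring
    · norm_num
      ring
  induction N with
  | zero =>
    have h0 : HasSum (fun n : ℤ => (n : ℂ) * (tripleCoeff q 0 n * ((-1) ^ n * q ^ tri n))) 0 := by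
      convert! hasSum_zero (α := ℂ) (β := ℤ) using 1
      ext n
      rcases lt_trichotomy n 0 with h | rfl | h
      · simp [tripleCoeff, qFacInv, h]
      · simp
      · simp [tripleCoeff, qFacInv, h]
    convert! key 0 _ _ h0 (hasSum_tripleCoeff hq hq0 hm 0) using 1
    simp [qFac]
  | succ N ih =>
    convert! key (N + 1) _ _ ih (hasSum_tripleCoeff hq hq0 hm (N + 1)) using 1
    -- The plain sum vanishes from here on: its product has the factor `1 - q^0` at `i = 0`.
    rw [Finset.prod_range_succ']
    simp [qFac, Finset.prod_range_succ]
    ring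

/-- Consecutive terms have ratio `c r^n`, so the ratio test applies in both directions. -/
lemma summable_pow_mul_pow_tri {c r : ℝ} (hc : 0 < c) (hr : 0 < r) (hr1 : r < 1) :
    Summable fun n : ℤ => c ^ n * r ^ tri n := by
  have step : ∀ n : ℤ, c ^ (n + 1) * r ^ tri (n + 1) / (c ^ n * r ^ tri n) = c * r ^ n := by
    intro n
    rw [tri_add_one, zpow_add₀ hr.ne', zpow_add₀ hc.ne', zpow_one]
    have := zpow_pos hc n
    have := zpow_pos hr (tri n)
    field_simp
  have hpos : ∀ n : ℤ, 0 < c ^ n * r ^ tri n := fun n => by positivity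
  have hlim : ∀ d : ℝ, Tendsto (fun n : ℕ => d * r ^ n) atTop (𝓝 0) := fun d => by
    simpa using (tendsto_pow_atTop_nhds_zero_of_lt_one hr.le hr1).const_mul d
  apply Summable.of_nat_of_neg
  · refine summable_of_ratio_test_tendsto_lt_one zero_lt_one
      (Eventually.of_forall fun n => (hpos n).ne') ((hlim c).congr fun n => ?_)
    rw [Real.norm_of_nonneg (hpos _).le, Real.norm_of_nonneg (hpos _).le]
    push_cast
    rw [step, zpow_natCast]
  · refine summable_of_ratio_test_tendsto_lt_one zero_lt_one
      (Eventually.of_forall fun n => (hpos _).ne') ((hlim (c⁻¹ * r)).congr fun n => ?_)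
    rw [Real.norm_of_nonneg (hpos _).le, Real.norm_of_nonneg (hpos _).le]
    have := step (-((n + 1 : ℕ) : ℤ))
    rw [show -((n + 1 : ℕ) : ℤ) + 1 = -(n : ℤ) by push_cast; ring] at this
    rw [← inv_div, this, mul_inv, ← zpow_neg, neg_neg, zpow_natCast, pow_succ]
    ring

/-- Uniform domination for the limit `N → ∞`: `(q;q)_k` and its reciprocal both converge, hence are
bounded. -/
lemma exists_norm_tripleCoeff_le {q : ℂ} (hq : ‖q‖ < 1) :
    ∃ C : ℝ, ∀ N n, ‖tripleCoeff q N n‖ ≤ C := by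
  obtain ⟨A, hA⟩ := (tendsto_qFac hq).norm.bddAbove_range
  obtain ⟨B, hB⟩ := ((tendsto_qFac hq).inv₀ (qPochInf_ne_zero hq hq)).norm.bddAbove_range
  have hA' : ∀ k, ‖qFac q k‖ ≤ A := fun k => hA ⟨k, rfl⟩
  have hB0 : 0 ≤ B := (norm_nonneg _).trans (hB ⟨0, rfl⟩)
  have hB' : ∀ k, ‖qFacInv q k‖ ≤ B := fun k => by
    unfold qFacInv
    split_ifs
    · exact hB ⟨k.toNat, rfl⟩
    · simpa using hB0
  refine ⟨A * B * B, fun N n => ?_⟩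
  rw [tripleCoeff, norm_mul, norm_mul]
  have hA0 : 0 ≤ A := (norm_nonneg _).trans (hA' 0)
  gcongr
  exacts [hA' _, hB' _, hB' _]

lemma tendsto_tripleCoeff {q : ℂ} (hq : ‖q‖ < 1) (n : ℤ) :
    Tendsto (fun N => tripleCoeff q N n) atTop (𝓝 (qPochInf q q)⁻¹) := by
  have hE := qPochInf_ne_zero hq hq
  have hinv : Tendsto (qFacInv q) atTop (𝓝 (qPochInf q q)⁻¹) := by
    have h1 : Tendsto (fun k : ℤ => k.toNat) atTop atTop :=
      tendsto_atTop.2 fun b => (eventually_ge_atTop (b : ℤ)).mono fun k hk => by omega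
    refine (((tendsto_qFac hq).inv₀ hE).comp h1).congr' ?_
    filter_upwards [eventually_ge_atTop (0 : ℤ)] with k hk
    simp [qFacInv, hk]
  have h2 : Tendsto (fun N : ℕ => 2 * N) atTop atTop :=
    tendsto_atTop.2 fun b => (eventually_ge_atTop b).mono fun k hk => by omega
  have h3 : Tendsto (fun N : ℕ => (N : ℤ) + n) atTop atTop :=
    tendsto_atTop_add_const_right _ _ tendsto_natCast_atTop_atTop
  have h4 : Tendsto (fun N : ℕ => (N : ℤ) - n) atTop atTop :=
    tendsto_atTop_add_const_right _ (-n) tendsto_natCast_atTop_atTop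
  convert! (((tendsto_qFac hq).comp h2).mul (hinv.comp h3)).mul (hinv.comp h4) using 2
  field_simp

lemma summable_norm_triple {q z : ℂ} (hq : ‖q‖ < 1) (hq0 : q ≠ 0) (hz : z ≠ 0) :
    Summable fun n : ℤ => ‖z ^ n * q ^ tri n‖ := by
  simpa using summable_pow_mul_pow_tri (norm_pos_iff.2 hz) (norm_pos_iff.2 hq0) hq

/-- **Jacobi's triple product identity.** -/
theorem hasSum_jacobi_triple_product {q z : ℂ} (hq : ‖q‖ < 1) (hq0 : q ≠ 0) (hz : z ≠ 0) :
    HasSum (fun n : ℤ => (-1) ^ n * z ^ n * q ^ tri n)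
      (qPochInf q q * qPochInf z q * qPochInf (q / z) q) := by
  have hE := qPochInf_ne_zero hq hq
  have hz' : -z ≠ 0 := neg_ne_zero.2 hz
  obtain ⟨C, hC⟩ := exists_norm_tripleCoeff_le hq
  have hs := summable_norm_triple hq hq0 hz'
  have hlim := tendsto_tsum_of_dominated_convergence (hs.mul_left C)
    (fun n => (tendsto_tripleCoeff hq n).mul_const ((-z) ^ n * q ^ tri n))
    (Eventually.of_forall fun N n => by
      rw [norm_mul]
      exact mul_le_mul_of_nonneg_right (hC N n) (norm_nonneg _))
  simp only [(hasSum_tripleCoeff hq hq0 hz' _).tsum_eq, Finset.prod_mul_distrib] at hlim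
  have hprod := (tendsto_prod_qPochInf hq z).mul (tendsto_prod_qPochInf hq (q / z))
  have heq := tendsto_nhds_unique hlim (hprod.congr fun N => by
    congr 1 <;> refine Finset.prod_congr rfl fun i _ => ?_
    · ring
    · field_simp
      ring)
  rw [tsum_mul_left] at heq
  have hval : ∑' n : ℤ, (-z) ^ n * q ^ tri n =
      qPochInf q q * qPochInf z q * qPochInf (q / z) q := by
    rw [mul_assoc, ← heq, mul_inv_cancel_left₀ hE]
  rw [← hval]
  convert! hs.of_norm.hasSum using 3 with n
  rw [← mul_zpow, neg_one_mul]

lemma summable_norm_pow_mul_tri {q : ℂ} (hq : ‖q‖ < 1) (hq0 : q ≠ 0) (k : ℕ) :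
    Summable fun n : ℤ => ‖(n : ℂ) ^ k * ((-1) ^ n * q ^ tri n)‖ := by
  -- Since `|n|^k ≤ (2^k)^|n|`, the weight is absorbed by taking `c = 2^k` for `n ≥ 0` and its
  -- inverse for `n ≤ 0`.
  have h2 := summable_pow_mul_pow_tri (c := 2 ^ k) (by positivity) (norm_pos_iff.2 hq0) hq
  have h3 := summable_pow_mul_pow_tri (c := (2 ^ k)⁻¹) (by positivity) (norm_pos_iff.2 hq0) hq
  refine (h2.add h3).of_nonneg_of_le (fun _ => norm_nonneg _) fun n => ?_
  rw [← add_mul, norm_mul, norm_mul, norm_zpow, norm_zpow, norm_neg, norm_one, one_zpow, one_mul,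
    norm_pow, Complex.norm_intCast]
  refine mul_le_mul_of_nonneg_right ?_ (by positivity)
  have hnat : ∀ m : ℕ, (m : ℝ) ^ k ≤ (2 ^ k) ^ m := fun m => by
    rw [← pow_mul, mul_comm, pow_mul]
    gcongr
    exact_mod_cast m.lt_two_pow_self.le
  rcases Int.eq_nat_or_neg n with ⟨m, rfl | rfl⟩
  · have : (0 : ℝ) < ((2 ^ k)⁻¹) ^ (m : ℤ) := by positivity
    have := hnat m
    simp only [zpow_natCast, Int.cast_natCast, Nat.abs_cast] at *
    linarith
  · have : (0 : ℝ) < (2 ^ k) ^ (-(m : ℤ)) := by positivity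
    have := hnat m
    simp only [zpow_natCast, Int.cast_neg, Int.cast_natCast, abs_neg, Nat.abs_cast, inv_zpow',
      neg_neg] at *
    linarith

/-- **Jacobi's identity** for the cube of Euler's product. -/
theorem hasSum_jacobi_cube {q : ℂ} (hq : ‖q‖ < 1) (hq0 : q ≠ 0) :
    HasSum (fun n : ℤ => (n : ℂ) * ((-1) ^ n * q ^ tri n)) (-qPochInf q q ^ 3) := by
  have hE := qPochInf_ne_zero hq hq
  obtain ⟨C, hC⟩ := exists_norm_tripleCoeff_le hq
  have hs := summable_norm_pow_mul_tri hq hq0 1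
  simp only [pow_one] at hs
  have hlim := tendsto_tsum_of_dominated_convergence (hs.mul_left C)
    (fun n => ((tendsto_tripleCoeff hq n).comp (tendsto_add_atTop_nat 1)).mul_const
      ((n : ℂ) * ((-1) ^ n * q ^ tri n)))
    (Eventually.of_forall fun N n => by
      rw [norm_mul]
      exact mul_le_mul_of_nonneg_right (hC (N + 1) n) (norm_nonneg _))
  have hval := fun N => (hasSum_mul_tripleCoeff hq hq0 N).tsum_eq
  simp only [mul_left_comm] at hval
  simp only [Function.comp_apply, mul_left_comm] at hlim
  simp only [hval] at hlim
  have heq := tendsto_nhds_unique hlim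
    ((tendsto_qFac hq).mul ((tendsto_qFac hq).comp (tendsto_add_atTop_nat 1))).neg
  simp only [mul_left_comm _ (qPochInf q q)⁻¹, tsum_mul_left] at heq
  have hval : ∑' n : ℤ, (n : ℂ) * ((-1) ^ n * q ^ tri n) = -qPochInf q q ^ 3 := by
    rw [inv_mul_eq_iff_eq_mul₀ hE] at heq
    rw [heq]
    ring
  rw [← hval]
  exact hs.of_norm.hasSum

/-! ### Theta series modulo five -/

/-- The exponents `a n + 5 n (n - 1) / 2` of the theta series with modulus five. -/
def thetaExp (a : ℕ) (n : ℤ) : ℕ := (a * n + 5 * tri n).toNat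

lemma natCast_thetaExp {a : ℕ} (ha : a ≤ 5) (n : ℤ) : (thetaExp a n : ℤ) = a * n + 5 * tri n := by
  refine Int.toNat_of_nonneg ?_
  have h := two_mul_tri n
  rcases lt_trichotomy n 0 with hn | rfl | hn
  · nlinarith [mul_nonneg (neg_nonneg.2 hn.le) (show 0 ≤ 5 - 5 * n - 2 * a by omega)]
  · simp [tri]
  · have : 0 ≤ (n : ℤ) - 1 := by omega
    nlinarith

/-- Distinct `m, n` with equal exponents would force `2a + 5(m+n-1) = 0`. Injectivity lets a theta
series be dominated by a power series in `‖q‖`. -/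
lemma thetaExp_injective {a : ℕ} (ha : a ≤ 5) (h5 : ¬ (5 : ℤ) ∣ 2 * a) :
    Function.Injective (thetaExp a) := by
  intro m n h
  have h' : (thetaExp a m : ℤ) = thetaExp a n := by rw [h]
  rw [natCast_thetaExp ha, natCast_thetaExp ha] at h'
  have hm := two_mul_tri m
  have hn := two_mul_tri n
  have : (m - n) * (2 * a + 5 * (m + n - 1)) = 0 := by linear_combination 2 * h' - 5 * hm + 5 * hn
  rcases mul_eq_zero.1 this with h1 | h1
  · omega
  · exact absurd ⟨-(m + n - 1), by linarith⟩ h5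

/-- The general term of the theta series with modulus five. -/
noncomputable def thetaTerm (a : ℕ) (q : ℂ) (n : ℤ) : ℂ := (-1) ^ n * q ^ thetaExp a n

lemma summable_norm_thetaTerm {a : ℕ} (ha : a ≤ 5) (h5 : ¬ (5 : ℤ) ∣ 2 * a) {q : ℂ}
    (hq : ‖q‖ < 1) : Summable fun n => ‖thetaTerm a q n‖ := by
  simpa [thetaTerm, Function.comp_def] using
    (summable_geometric_of_lt_one (norm_nonneg _) hq).comp_injective (thetaExp_injective ha h5)

lemma summable_norm_mul_thetaTerm {a : ℕ} (ha : a ≤ 5) (h5 : ¬ (5 : ℤ) ∣ 2 * a) {q : ℂ}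
    (hq : ‖q‖ < 1) : Summable fun n => ‖(thetaExp a n : ℂ) * thetaTerm a q n‖ := by
  have h := summable_pow_mul_geometric_of_norm_lt_one 1 (r := ‖q‖) (by simpa using hq)
  simpa [thetaTerm, Function.comp_def] using h.comp_injective (thetaExp_injective ha h5)

/-- The triple product with `q` replaced by `q^5` and `z = q^a`. -/
lemma hasSum_thetaTerm {a : ℕ} (ha : a ≤ 5) {q : ℂ} (hq : ‖q‖ < 1) (hq0 : q ≠ 0) :
    HasSum (thetaTerm a q)
      (qPochInf (q ^ 5) (q ^ 5) * qPochInf (q ^ a) (q ^ 5) * qPochInf (q ^ (5 - a)) (q ^ 5)) := by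
  have h5 : ‖q ^ 5‖ < 1 := by
    rw [norm_pow]
    exact pow_lt_one₀ (norm_nonneg _) hq (by norm_num)
  convert! hasSum_jacobi_triple_product h5 (pow_ne_zero 5 hq0) (pow_ne_zero a hq0) using 1
  · ext n
    rw [thetaTerm, ← zpow_natCast q (thetaExp a n), natCast_thetaExp ha, zpow_add₀ hq0, zpow_mul,
      zpow_mul, mul_assoc]
    norm_cast
  · rw [pow_sub₀ _ hq0 ha, div_eq_mul_inv]

/-! ### The sixth power of Euler's product as a lattice sum -/

/-- The general term of the double series for `-32 (q;q)_∞⁶`. -/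
noncomputable def latticeTerm (q : ℂ) (p : ℤ × ℤ) : ℂ :=
  (3 * ((2 * p.1 - 1) ^ 2 - (2 * p.2 - 1) ^ 2) - 8 * ((2 * p.1 - 1) * (2 * p.2 - 1))) *
    ((-1) ^ (p.1 + p.2) * q ^ (tri p.1 + tri p.2))

lemma hasSum_latticeTerm {q : ℂ} (hq : ‖q‖ < 1) (hq0 : q ≠ 0) :
    HasSum (latticeTerm q) (-32 * qPochInf q q ^ 6) := by
  have hs := summable_norm_pow_mul_tri hq hq0
  -- At `z = 1` the triple product has a zero factor. So only the `xy` part of the weight survives,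
  -- with coefficient `-8 · 4`.
  have h0 : ∑' n : ℤ, (n : ℂ) ^ 0 * ((-1) ^ n * q ^ tri n) = 0 := by
    have := (hasSum_jacobi_triple_product hq hq0 one_ne_zero).tsum_eq
    have h1 : qPochInf 1 q = 0 :=
      tprod_of_exists_eq_zero ⟨0, by simp⟩
    simpa [h1] using this
  have h1 : ∑' n : ℤ, (n : ℂ) ^ 1 * ((-1) ^ n * q ^ tri n) = -qPochInf q q ^ 3 := by
    simpa using (hasSum_jacobi_cube hq hq0).tsum_eq
  have hmul : ∀ k l : ℕ, HasSum (fun p : ℤ × ℤ =>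
      ((p.1 : ℂ) ^ k * ((-1) ^ p.1 * q ^ tri p.1)) * ((p.2 : ℂ) ^ l * ((-1) ^ p.2 * q ^ tri p.2)))
      ((∑' n : ℤ, (n : ℂ) ^ k * ((-1) ^ n * q ^ tri n)) *
        ∑' n : ℤ, (n : ℂ) ^ l * ((-1) ^ n * q ^ tri n)) := fun k l => by
    rw [tsum_mul_tsum_of_summable_norm (hs k) (hs l)]
    exact (summable_mul_of_summable_norm (hs k) (hs l)).hasSum
  convert! (((((hmul 2 0).sub (hmul 1 0)).sub (hmul 0 2)).add (hmul 0 1)).mul_left 12).sub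
    ((((((hmul 1 1).mul_left 4).sub ((hmul 1 0).mul_left 2)).sub
      ((hmul 0 1).mul_left 2)).add (hmul 0 0)).mul_left 8) using 1
  · ext p
    rw [latticeTerm, zpow_add₀ (by norm_num : (-1 : ℂ) ≠ 0), zpow_add₀ hq0]
    ring
  · rw [h0, h1]
    ring

lemma neg_one_zpow_eq {a b : ℤ} (k : ℤ) (h : a = b + 2 * k) : (-1 : ℂ) ^ a = (-1) ^ b := by
  rw [h, zpow_add₀ (by norm_num), zpow_mul]
  norm_num

/-- The points `p` of the lattice with `p.1 + 2 p.2 ≡ c` modulo five. -/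
def latticeClass (c : ℤ) : Set (ℤ × ℤ) := {p | (p.1 + 2 * p.2) % 5 = c}

/-- The quarter turn of the lattice. -/
def latticeRotation : ℤ × ℤ ≃ ℤ × ℤ where
  toFun p := (1 - p.2, p.1)
  invFun p := (p.2, 1 - p.1)
  left_inv p := by simp
  right_inv p := by simp

/-- In the coordinates `x, y` this is `(x, y) ↦ (-y, x)`: the quadratic weight and the sign
`(-1)^(i+j)` both change sign. -/
lemma latticeTerm_rotation (q : ℂ) (p : ℤ × ℤ) :
    latticeTerm q (latticeRotation p) = latticeTerm q p := by
  obtain ⟨i, j⟩ := p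
  have hs : (-1 : ℂ) ^ (1 - j + i) = -(-1) ^ (i + j) := by
    rw [show 1 - j + i = (i + j) + 1 + 2 * (-j) by ring, neg_one_zpow_eq (-j) rfl,
      zpow_add₀ (by norm_num), zpow_one, mul_neg_one]
  simp only [latticeTerm, latticeRotation, Equiv.coe_fn_mk, tri_one_sub, hs, add_comm (tri j)]
  push_cast
  ring

lemma tsum_indicator_latticeClass_rotation (q : ℂ) {c c' : ℤ} (hc : 0 ≤ c) (hc5 : c < 5)
    (hc' : c' = (2 * c + 1) % 5) :
    ∑' p, (latticeClass c').indicator (latticeTerm q) p =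
      ∑' p, (latticeClass c).indicator (latticeTerm q) p := by
  rw [← latticeRotation.tsum_eq]
  refine tsum_congr fun p => ?_
  have hmem : latticeRotation p ∈ latticeClass c' ↔ p ∈ latticeClass c := by
    simp only [latticeClass, latticeRotation, Equiv.coe_fn_mk, Set.mem_ofPred_eq]
    omega
  by_cases h : p ∈ latticeClass c
  · rw [Set.indicator_of_mem h, Set.indicator_of_mem (hmem.2 h), latticeTerm_rotation]
  · rw [Set.indicator_of_notMem h, Set.indicator_of_notMem fun h' => h (hmem.1 h')]

lemma tsum_indicator_comp {α β : Type*} {f : β → ℂ} {s : Set β} {φ : α → β}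
    (hφ : Function.Injective φ) (hs : Set.range φ = s) :
    ∑' b, s.indicator f b = ∑' a, f (φ a) := by
  have hsupp : Function.support (s.indicator f) ⊆ Set.range φ :=
    hs ▸ Set.support_indicator_subset
  rw [← hφ.tsum_eq hsupp]
  refine tsum_congr fun a => Set.indicator_of_mem (hs ▸ ⟨a, rfl⟩) f

/-- On this class `x + iy = (2-i)(u + iv)` with `u, v` odd, so the weight becomes `25(u² - v²)`, odd
under swapping `u` and `v`, while the sign and the power of `q` are symmetric. -/
lemma tsum_indicator_latticeClass_four (q : ℂ) :
    ∑' p, (latticeClass 4).indicator (latticeTerm q) p = 0 := by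
  let φ : ℤ × ℤ → ℤ × ℤ := fun p => (2 * p.1 + p.2 + 2, 2 * p.2 - p.1 + 1)
  have hinj : Function.Injective φ := fun p p' h => by
    simp only [φ, Prod.mk.injEq] at h
    ext <;> omega
  have hrange : Set.range φ = latticeClass 4 := by
    ext ⟨i, j⟩
    simp only [φ, Set.mem_range, latticeClass, Set.mem_ofPred_eq, Prod.mk.injEq, Prod.exists]
    refine ⟨fun ⟨a, b, h1, h2⟩ => by omega, fun h => ?_⟩
    refine ⟨(2 * i - j - 3) / 5, (i + 2 * j - 4) / 5, ?_, ?_⟩ <;> omega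
  rw [tsum_indicator_comp hinj hrange]
  have hswap : ∀ p : ℤ × ℤ, latticeTerm q (φ p.swap) = -latticeTerm q (φ p) := fun ⟨a, b⟩ => by
    have h1 : (-1 : ℂ) ^ (2 * b + a + 2 + (2 * a - b + 1)) =
        (-1) ^ (2 * a + b + 2 + (2 * b - a + 1)) := neg_one_zpow_eq (a - b) (by ring)
    have h2 : tri (2 * b + a + 2) + tri (2 * a - b + 1) =
        tri (2 * a + b + 2) + tri (2 * b - a + 1) := by
      have e1 := two_mul_tri (2 * b + a + 2)
      have e2 := two_mul_tri (2 * a - b + 1)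
      have e3 := two_mul_tri (2 * a + b + 2)
      have e4 := two_mul_tri (2 * b - a + 1)
      linarith
    simp only [φ, latticeTerm, Prod.swap, h1, h2]
    push_cast
    ring
  have h := (Equiv.prodComm ℤ ℤ).tsum_eq fun p => latticeTerm q (φ p)
  simp only [Equiv.prodComm_apply, hswap, tsum_neg] at h
  linear_combination (-1 / 2) * h

/-- On this class `(2+i)(x+iy) = (10m-3) + i(1-10n)`, so the weight is `(10m-3)² - (10n-1)² = 8 +
40(e₁ - e₂)`, where `e₁, e₂` are the two theta exponents. -/
lemma tsum_indicator_latticeClass_two {q : ℂ} (hq0 : q ≠ 0) :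
    ∑' p, (latticeClass 2).indicator (latticeTerm q) p =
      -8 * ∑' p : ℤ × ℤ, (thetaTerm 1 q p.1 * thetaTerm 2 q p.2 +
        5 * (thetaExp 1 p.1 * thetaTerm 1 q p.1 * thetaTerm 2 q p.2 -
          thetaTerm 1 q p.1 * (thetaExp 2 p.2 * thetaTerm 2 q p.2))) := by
  let φ : ℤ × ℤ → ℤ × ℤ := fun p => (2 * p.1 - p.2, -2 * p.2 - p.1 + 1)
  have hinj : Function.Injective φ := fun p p' h => by
    simp only [φ, Prod.mk.injEq] at h
    ext <;> omega
  have hrange : Set.range φ = latticeClass 2 := by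
    ext ⟨i, j⟩
    simp only [φ, Set.mem_range, latticeClass, Set.mem_ofPred_eq, Prod.mk.injEq, Prod.exists]
    refine ⟨fun ⟨a, b, h1, h2⟩ => by omega, fun h => ?_⟩
    refine ⟨(2 * i - j + 1) / 5, (2 - i - 2 * j) / 5, ?_, ?_⟩ <;> omega
  rw [tsum_indicator_comp hinj hrange, ← tsum_mul_left]
  refine tsum_congr fun ⟨m, n⟩ => ?_
  have h1 : (-1 : ℂ) ^ (2 * m - n + (-2 * n - m + 1)) = -((-1) ^ m * (-1) ^ n) := by
    rw [show 2 * m - n + (-2 * n - m + 1) = (m + n) + 1 + 2 * (-2 * n) by ring,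
      neg_one_zpow_eq (-2 * n) rfl, zpow_add₀ (by norm_num), zpow_add₀ (by norm_num), zpow_one,
      mul_neg_one]
  have e1 := two_mul_tri (2 * m - n)
  have e2 := two_mul_tri (-2 * n - m + 1)
  have e3 := two_mul_tri m
  have e4 := two_mul_tri n
  have t1 := natCast_thetaExp (a := 1) (by norm_num) m
  have t2 := natCast_thetaExp (a := 2) (by norm_num) n
  push_cast at t1 t2
  have h2 : tri (2 * m - n) + tri (-2 * n - m + 1) = (thetaExp 1 m : ℤ) + thetaExp 2 n := by
    linarith
  have h3 : (2 * (thetaExp 1 m : ℂ)) = 5 * m ^ 2 - 3 * m := by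
    have : 2 * (thetaExp 1 m : ℤ) = 5 * m ^ 2 - 3 * m := by linarith
    exact_mod_cast this
  have h4 : (2 * (thetaExp 2 n : ℂ)) = 5 * n ^ 2 - n := by
    have : 2 * (thetaExp 2 n : ℤ) = 5 * n ^ 2 - n := by linarith
    exact_mod_cast this
  simp only [φ, latticeTerm, thetaTerm, h1, h2, zpow_add₀ hq0, zpow_natCast]
  push_cast
  linear_combination (-1 : ℂ) ^ m * (-1) ^ n * q ^ thetaExp 1 m * q ^ thetaExp 2 n *
    (20 * h3 - 20 * h4)

/-- A Wronskian of the two theta series with modulus five is the sixth power of Euler's product. -/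
theorem theta_wronskian {q : ℂ} (hq : ‖q‖ < 1) (hq0 : q ≠ 0) :
    (∑' n, thetaTerm 1 q n) * (∑' n, thetaTerm 2 q n) +
      5 * ((∑' n, thetaExp 1 n * thetaTerm 1 q n) * (∑' n, thetaTerm 2 q n) -
        (∑' n, thetaTerm 1 q n) * (∑' n, thetaExp 2 n * thetaTerm 2 q n)) =
      qPochInf q q ^ 6 := by
  have hF := hasSum_latticeTerm hq hq0
  have hsplit : ∑' p, latticeTerm q p =
      ∑ c ∈ Finset.range 5, ∑' p, (latticeClass (c : ℤ)).indicator (latticeTerm q) p := by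
    rw [← Summable.tsum_finsetSum fun c _ => hF.summable.indicator _]
    refine tsum_congr fun p => ?_
    have hp : ((p.1 + 2 * p.2) % 5).toNat ∈ Finset.range 5 := by
      rw [Finset.mem_range]; omega
    rw [Finset.sum_eq_single_of_mem _ hp fun c _ hc => Set.indicator_of_notMem (fun h => hc ?_) _,
      Set.indicator_of_mem]
    · simp only [latticeClass, Set.mem_ofPred_eq]
      omega
    · simp only [latticeClass, Set.mem_ofPred_eq] at h
      omega
  simp only [Finset.sum_range_succ, Finset.sum_range_zero, Nat.cast_ofNat, Nat.cast_zero,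
    Nat.cast_one, tsum_indicator_latticeClass_four] at hsplit
  -- The rotation acts on classes by `c ↦ 2c + 1`, with cycle `2 → 0 → 1 → 3 → 2` and fixed point
  -- `4`.
  have r0 := tsum_indicator_latticeClass_rotation q (c := 2) (c' := 0) (by norm_num) (by norm_num)
    (by norm_num)
  have r1 := tsum_indicator_latticeClass_rotation q (c := 0) (c' := 1) (by norm_num) (by norm_num)
    (by norm_num)
  have r3 := tsum_indicator_latticeClass_rotation q (c := 1) (c' := 3) (by norm_num) (by norm_num)
    (by norm_num)
  have s1 := summable_norm_thetaTerm (a := 1) (by norm_num) (by norm_num) hq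
  have s2 := summable_norm_thetaTerm (a := 2) (by norm_num) (by norm_num) hq
  have w1 := summable_norm_mul_thetaTerm (a := 1) (by norm_num) (by norm_num) hq
  have w2 := summable_norm_mul_thetaTerm (a := 2) (by norm_num) (by norm_num) hq
  have p0 := (summable_mul_of_summable_norm s1 s2).hasSum
  have p1 := (summable_mul_of_summable_norm w1 s2).hasSum
  have p2 := (summable_mul_of_summable_norm s1 w2).hasSum
  rw [← tsum_mul_tsum_of_summable_norm s1 s2] at p0
  rw [← tsum_mul_tsum_of_summable_norm w1 s2] at p1
  rw [← tsum_mul_tsum_of_summable_norm s1 w2] at p2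
  have h2 := tsum_indicator_latticeClass_two hq0
  rw [(p0.add ((p1.sub p2).mul_left 5)).tsum_eq] at h2
  rw [r3, r1, r0, h2, hF.tsum_eq] at hsplit
  linear_combination (1 / 32) * hsplit

/-! ### Logarithmic derivatives and Lambert series -/

lemma norm_pow_lt_one {q : ℂ} (hq : ‖q‖ < 1) {n : ℕ} (hn : n ≠ 0) : ‖q ^ n‖ < 1 := by
  rw [norm_pow]
  exact pow_lt_one₀ (norm_nonneg _) hq hn

lemma multipliableLocallyUniformlyOn_residue (a : ℕ) :
    MultipliableLocallyUniformlyOn (fun (n : ℕ) (q : ℂ) => 1 - q ^ a * (q ^ 5) ^ n)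
      (Metric.ball (0 : ℂ) 1) := by
  use fun q => ∏' n : ℕ, (1 - q ^ a * (q ^ 5) ^ n)
  simp_rw [sub_eq_add_neg]
  apply hasProdLocallyUniformlyOn_of_forall_compact Metric.isOpen_ball
  intro K hK hcK
  rcases K.eq_empty_or_nonempty with hN | hN
  · simpa [hasProdUniformlyOn_iff_tendstoUniformlyOn, hN] using tendstoUniformlyOn_empty
  -- A point of largest modulus in `K` supplies a geometric majorant valid on all of `K`.
  · obtain ⟨q₀, hq₀, _, HB⟩ := hcK.exists_sSup_image_eq_and_ge hN
      (show ContinuousOn (fun q : ℂ => ‖q‖) K by fun_prop)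
    have hq₀1 : ‖q₀‖ < 1 := by simpa using hK hq₀
    have hsum : Summable fun n : ℕ => ‖q₀‖ ^ a * (‖q₀‖ ^ 5) ^ n :=
      (summable_geometric_of_lt_one (by positivity)
        (pow_lt_one₀ (norm_nonneg _) hq₀1 (by norm_num))).mul_left _
    refine hsum.hasProdUniformlyOn_nat_one_add hcK (.of_forall fun n x hx => ?_)
      (fun _ => by fun_prop)
    rw [norm_neg, norm_mul, norm_pow, norm_pow, norm_pow]
    have := HB x hx
    gcongr

lemma differentiableAt_qPochInf_residue (a : ℕ) {q : ℂ} (hq : ‖q‖ < 1) :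
    DifferentiableAt ℂ (fun x => qPochInf (x ^ a) (x ^ 5)) q := by
  have h : DifferentiableOn ℂ (fun x : ℂ => ∏' n : ℕ, (1 - x ^ a * (x ^ 5) ^ n))
      (Metric.ball (0 : ℂ) 1) :=
    (multipliableLocallyUniformlyOn_residue a).hasProdLocallyUniformlyOn.differentiableOn
      (.of_forall fun _ => by
        simpa [Finset.prod_fn] using DifferentiableOn.finsetProd (fun _ _ => by fun_prop))
      Metric.isOpen_ball
  exact h.differentiableAt (Metric.isOpen_ball.mem_nhds (by simpa using hq))

/-- The Lambert series over the exponents congruent to `a` modulo five. -/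
noncomputable def lambertResidue (a : ℕ) (q : ℂ) : ℂ :=
  ∑' n : ℕ, ((a + 5 * n : ℕ) : ℂ) * q ^ (a + 5 * n) / (1 - q ^ (a + 5 * n))

lemma summable_lambert {q : ℂ} (hq : ‖q‖ < 1) :
    Summable fun n : ℕ => (n : ℂ) * q ^ n / (1 - q ^ n) := by
  simpa using summable_norm_pow_mul_geometric_div_one_sub 1 hq

lemma summable_lambertResidue (a : ℕ) {q : ℂ} (hq : ‖q‖ < 1) :
    Summable fun n : ℕ => ((a + 5 * n : ℕ) : ℂ) * q ^ (a + 5 * n) / (1 - q ^ (a + 5 * n)) :=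
  (summable_lambert hq).comp_injective (i := fun n : ℕ => a + 5 * n) fun m n h => by
    simp only at h
    omega

lemma mul_logDeriv_qPochInf_residue {a : ℕ} (ha : a ≠ 0) {q : ℂ} (hq : ‖q‖ < 1) (hq0 : q ≠ 0) :
    q * logDeriv (fun x => qPochInf (x ^ a) (x ^ 5)) q = -lambertResidue a q := by
  have h5 := norm_pow_lt_one hq (n := 5) (by norm_num)
  have hqa := norm_pow_lt_one hq ha
  have hterm : ∀ n : ℕ, logDeriv (fun x : ℂ => 1 - x ^ a * (x ^ 5) ^ n) q =
      -q⁻¹ * (((a + 5 * n : ℕ) : ℂ) * q ^ (a + 5 * n) / (1 - q ^ (a + 5 * n))) := fun n => by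
    have hf : (fun x : ℂ => 1 - x ^ a * (x ^ 5) ^ n) = fun x => 1 - x ^ (a + 5 * n) := by
      ext x
      rw [pow_add, pow_mul]
    have hd : HasDerivAt (fun x : ℂ => 1 - x ^ (a + 5 * n))
        (-(((a + 5 * n : ℕ) : ℂ) * q ^ (a + 5 * n - 1))) q :=
      (hasDerivAt_pow (a + 5 * n) q).const_sub 1
    rw [hf, logDeriv_apply, hd.deriv]
    have hp : q ^ (a + 5 * n) = q ^ (a + 5 * n - 1) * q := by
      rw [← pow_succ]
      congr 1
      omega
    rw [hp]
    field_simp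
  have H := logDeriv_tprod_eq_tsum (f := fun (n : ℕ) (x : ℂ) => 1 - x ^ a * (x ^ 5) ^ n)
    Metric.isOpen_ball (x := q) (by simpa using hq) (one_sub_mul_pow_ne_zero h5 hqa)
    (fun n => by fun_prop) (by
      simp only [hterm]
      exact (summable_lambertResidue a hq).mul_left _)
    (multipliableLocallyUniformlyOn_residue a) (qPochInf_ne_zero h5 hqa)
  simp only [hterm, tsum_mul_left] at H
  unfold qPochInf
  rw [H, lambertResidue]
  field_simp

lemma exists_hasDerivAt_theta {a : ℕ} (ha : a ≤ 5) (h5 : ¬ (5 : ℤ) ∣ 2 * a) {q : ℂ}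
    (hq : ‖q‖ < 1) : ∃ D, HasDerivAt (fun x => ∑' n, thetaTerm a x n) D q ∧
      q * D = ∑' n, thetaExp a n * thetaTerm a q n := by
  -- On the ball of radius `r` the termwise derivatives are dominated by a subseries of `∑ k
  -- r^(k-1)`.
  obtain ⟨r, hqr, hr1⟩ := exists_between hq
  have hr0 : 0 ≤ r := (norm_nonneg q).trans hqr.le
  have hu : Summable fun k : ℕ => (k : ℝ) * r ^ (k - 1) := by
    rw [← summable_nat_add_iff 1]
    have h1 := summable_pow_mul_geometric_of_norm_lt_one 1 (r := r)
      (by rwa [Real.norm_of_nonneg hr0])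
    have h2 := summable_geometric_of_lt_one hr0 hr1
    refine (h1.add h2).congr fun k => ?_
    push_cast
    simp
    ring
  refine ⟨∑' n, (-1) ^ n * (thetaExp a n * q ^ (thetaExp a n - 1)), ?_, ?_⟩
  · refine hasDerivAt_tsum_of_isPreconnected (t := Metric.ball (0 : ℂ) r)
      (g := fun n x => thetaTerm a x n) (g' := fun n x => (-1) ^ n *
        (thetaExp a n * x ^ (thetaExp a n - 1)))
      (hu.comp_injective (thetaExp_injective ha h5)) Metric.isOpen_ball
      (convex_ball _ _).isPreconnected (fun n y _ => (hasDerivAt_pow _ y).const_mul _)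
      (fun n y hy => ?_) (y₀ := q) (by simpa using hqr)
      (summable_norm_thetaTerm ha h5 hq).of_norm (by simpa using hqr)
    have hy' : ‖y‖ ≤ r := by
      have : ‖y‖ < r := by simpa using hy
      exact this.le
    simp only [norm_mul, norm_zpow, norm_neg, norm_one, one_zpow, one_mul, norm_pow,
      Complex.norm_natCast, Function.comp_apply]
    gcongr
  · rw [← tsum_mul_left]
    refine tsum_congr fun n => ?_
    rw [thetaTerm]
    rcases Nat.eq_zero_or_pos (thetaExp a n) with h | h
    · simp [h]
    · have hp : q ^ thetaExp a n = q ^ (thetaExp a n - 1) * q := by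
        rw [← pow_succ]
        congr 1
        omega
      rw [hp]
      ring

/-- Both sides compute `q θ_a'`: the left termwise, the right from the logarithmic derivative of the
product. -/
lemma tsum_thetaExp_mul_thetaTerm {a : ℕ} (ha0 : a ≠ 0) (ha : a < 5) {q : ℂ} (hq : ‖q‖ < 1)
    (hq0 : q ≠ 0) : ∑' n, thetaExp a n * thetaTerm a q n =
      -(lambertResidue 5 q + lambertResidue a q + lambertResidue (5 - a) q) *
        ∑' n, thetaTerm a q n := by
  have h5 := norm_pow_lt_one hq (n := 5) (by norm_num)
  have ha' : 5 - a ≠ 0 := by omega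
  obtain ⟨D, hD, hqD⟩ := exists_hasDerivAt_theta ha.le (by omega) hq
  have heq : (fun x => ∑' n, thetaTerm a x n) =ᶠ[𝓝 q] fun x =>
      qPochInf (x ^ 5) (x ^ 5) * qPochInf (x ^ a) (x ^ 5) * qPochInf (x ^ (5 - a)) (x ^ 5) := by
    filter_upwards [Metric.isOpen_ball.mem_nhds (show q ∈ Metric.ball (0 : ℂ) 1 by simpa using hq),
      isOpen_ne.mem_nhds hq0] with x hx hx0
    exact (hasSum_thetaTerm ha.le (by simpa using hx) hx0).tsum_eq
  have n1 := qPochInf_ne_zero h5 h5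
  have n2 := qPochInf_ne_zero h5 (norm_pow_lt_one hq ha0)
  have n3 := qPochInf_ne_zero h5 (norm_pow_lt_one hq ha')
  have d1 := differentiableAt_qPochInf_residue 5 hq
  have d2 := differentiableAt_qPochInf_residue a hq
  have d3 := differentiableAt_qPochInf_residue (5 - a) hq
  have hlog := (logDeriv_congr_nhds heq).self_of_nhds
  rw [logDeriv_mul (f := fun x => qPochInf (x ^ 5) (x ^ 5) * qPochInf (x ^ a) (x ^ 5)) q
    (mul_ne_zero n1 n2) n3 (d1.mul d2) d3, logDeriv_mul q n1 n2 d1 d2, logDeriv_apply,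
    hD.deriv] at hlog
  have hne : ∑' n, thetaTerm a q n ≠ 0 := by
    rw [(hasSum_thetaTerm ha.le hq hq0).tsum_eq]
    exact mul_ne_zero (mul_ne_zero n1 n2) n3
  rw [div_eq_iff hne] at hlog
  rw [← hqD, hlog, ← mul_assoc, mul_add, mul_add, mul_logDeriv_qPochInf_residue (by norm_num) hq hq0,
    mul_logDeriv_qPochInf_residue ha0 hq hq0, mul_logDeriv_qPochInf_residue ha' hq hq0]
  ring

/-! ### Residue classes modulo five and conclusion -/

lemma qPochInf_eq_prod_residues {q : ℂ} (hq : ‖q‖ < 1) :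
    qPochInf q q = qPochInf (q ^ 1) (q ^ 5) * qPochInf (q ^ 2) (q ^ 5) * qPochInf (q ^ 3) (q ^ 5) *
      qPochInf (q ^ 4) (q ^ 5) * qPochInf (q ^ 5) (q ^ 5) := by
  have h5 := norm_pow_lt_one hq (n := 5) (by norm_num)
  have hl := (tendsto_prod_qPochInf hq q).comp
    (tendsto_atTop.2 fun b => (eventually_ge_atTop b).mono fun k hk => by omega :
      Tendsto (fun N : ℕ => 5 * N) atTop atTop)
  have hr := ((((tendsto_prod_qPochInf h5 (q ^ 1)).mul (tendsto_prod_qPochInf h5 (q ^ 2))).mul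
    (tendsto_prod_qPochInf h5 (q ^ 3))).mul (tendsto_prod_qPochInf h5 (q ^ 4))).mul
    (tendsto_prod_qPochInf h5 (q ^ 5))
  refine tendsto_nhds_unique hl (hr.congr fun N => ?_)
  simp only [← Finset.prod_mul_distrib, Function.comp_apply]
  induction N with
  | zero => simp
  | succ N ih =>
    rw [Finset.prod_range_succ, ih, mul_add, mul_one]
    simp only [Finset.prod_range_succ]
    ring

lemma norm_legendreSym_le_one (n : ℤ) : ‖(legendreSym 5 n : ℂ)‖ ≤ 1 := by
  by_cases h : (n : ZMod 5) = 0
  · simp [(legendreSym.eq_zero_iff 5 n).2 h]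
  · rcases legendreSym.eq_one_or_neg_one 5 h with h | h <;> simp [h]

lemma summable_legendre_lambert {q : ℂ} (hq : ‖q‖ < 1) :
    Summable fun n : ℕ => (legendreSym 5 (n : ℤ) : ℂ) * ((n : ℂ) * q ^ n / (1 - q ^ n)) := by
  refine Summable.of_norm_bounded (summable_lambert hq).norm fun n => ?_
  rw [norm_mul]
  exact mul_le_of_le_one_left (norm_nonneg _) (norm_legendreSym_le_one n)

lemma tsum_legendre_lambert {q : ℂ} (hq : ‖q‖ < 1) :
    ∑' n : ℕ, (legendreSym 5 (n : ℤ) : ℂ) * ((n : ℂ) * q ^ n / (1 - q ^ n)) =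
      lambertResidue 1 q - lambertResidue 2 q - lambertResidue 3 q + lambertResidue 4 q := by
  rw [Nat.sumByResidueClasses (summable_legendre_lambert hq) 5]
  have hχ : ∀ j m : ℕ, legendreSym 5 ((j + 5 * m : ℕ) : ℤ) = legendreSym 5 j := fun j m => by
    rw [legendreSym.mod 5 ((j + 5 * m : ℕ) : ℤ), legendreSym.mod 5 (j : ℤ)]
    congr 1
    omega
  simp only [hχ, tsum_mul_left]
  have h0 : legendreSym 5 0 = 0 := by norm_num
  have h1 : legendreSym 5 1 = 1 := by norm_num
  have h2 : legendreSym 5 2 = -1 := by norm_num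
  have h3 : legendreSym 5 3 = -1 := by norm_num
  have h4 : legendreSym 5 4 = 1 := by norm_num
  -- `ZMod 5` unfolds to `Fin 5`, so the sum over residues can be written out.
  have hsum : ∀ g : ℕ → ℂ, ∑ j : ZMod 5, g j.val = g 0 + g 1 + g 2 + g 3 + g 4 := fun g =>
    Fin.sum_univ_five fun j : Fin 5 => g j
  rw [hsum fun j => (legendreSym 5 (j : ℤ) : ℂ) *
    ∑' m : ℕ, ((j + 5 * m : ℕ) : ℂ) * q ^ (j + 5 * m) / (1 - q ^ (j + 5 * m))]
  simp only [Nat.cast_zero, Nat.cast_one, Nat.cast_ofNat, h0, h1, h2, h3, h4]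
  simp only [lambertResidue]
  push_cast
  ring

lemma one_sub_legendre_lambert {q : ℂ} (hq : ‖q‖ < 1) (hq0 : q ≠ 0) :
    1 - 5 * ∑' n : ℕ, (legendreSym 5 (n : ℤ) : ℂ) * ((n : ℂ) * q ^ n / (1 - q ^ n)) =
      qPochInf q q ^ 5 / qPochInf (q ^ 5) (q ^ 5) := by
  have h5 := norm_pow_lt_one hq (n := 5) (by norm_num)
  have hE5 := qPochInf_ne_zero h5 h5
  have hE := qPochInf_ne_zero hq hq
  have hw := theta_wronskian hq hq0
  have t1 := tsum_thetaExp_mul_thetaTerm (a := 1) (by norm_num) (by norm_num) hq hq0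
  have t2 := tsum_thetaExp_mul_thetaTerm (a := 2) (by norm_num) (by norm_num) hq hq0
  have hprod : (∑' n, thetaTerm 1 q n) * (∑' n, thetaTerm 2 q n) =
      qPochInf q q * qPochInf (q ^ 5) (q ^ 5) := by
    rw [(hasSum_thetaTerm (by norm_num) hq hq0).tsum_eq,
      (hasSum_thetaTerm (by norm_num) hq hq0).tsum_eq, qPochInf_eq_prod_residues hq]
    ring
  norm_num at t1 t2
  rw [tsum_legendre_lambert hq, eq_div_iff hE5]
  refine mul_left_cancel₀ hE ?_
  -- `lambertResidue 5` occurs in both logarithmic derivatives and cancels in the Wronskian.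
  rw [t1, t2] at hw
  linear_combination hw - (1 - 5 * (lambertResidue 1 q - lambertResidue 2 q -
    lambertResidue 3 q + lambertResidue 4 q)) * hprod

/-- For every complex `q` in the open unit disc the series and both infinite products converge, the
denominator does not vanish, and `1 - 5 ∑_{n ≥ 1} (n/5) n qⁿ/(1-qⁿ) = (q;q)_∞⁵ / (q⁵;q⁵)_∞`. -/
theorem theorem5p2 (q : ℂ) (hq : ‖q‖ < 1) :
    Summable (fun n : ℕ+ => (legendreSym 5 (n : ℤ) : ℂ) *
      ((n : ℂ) * q ^ (n : ℕ) / (1 - q ^ (n : ℕ)))) ∧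
    Multipliable (fun n : ℕ => 1 - q * q ^ n) ∧
    Multipliable (fun n : ℕ => 1 - q ^ 5 * (q ^ 5) ^ n) ∧
    qPochInf (q ^ 5) (q ^ 5) ≠ 0 ∧
    1 - 5 * ∑' n : ℕ+, (legendreSym 5 (n : ℤ) : ℂ) *
        ((n : ℂ) * q ^ (n : ℕ) / (1 - q ^ (n : ℕ))) =
      qPochInf q q ^ 5 / qPochInf (q ^ 5) (q ^ 5) := by
  have h5 := norm_pow_lt_one hq (n := 5) (by norm_num)
  refine ⟨summable_pnat_iff_summable_nat.2 (summable_legendre_lambert hq),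
    multipliable_one_sub_mul_pow hq q, multipliable_one_sub_mul_pow h5 (q ^ 5),
    qPochInf_ne_zero h5 h5, ?_⟩
  -- The integer powers of `q` above need `q ≠ 0`; at `q = 0` both sides are 1.
  rcases eq_or_ne q 0 with rfl | hq0
  · simp [qPochInf]
  · rw [← one_sub_legendre_lambert hq hq0,
      ← tsum_zero_pnat_eq_tsum_nat (summable_legendre_lambert hq)]
    simp
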